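/- Let $n\ge 0$ and $m\ge 1$, and let $A\in\mathbb{R}^{n\times n}$, $B\in\mathbb{R}^{n\times m}$, $C\in\mathbb{R}^{m\times n}$, $D\in\mathbb{R}^{m\times m}$ be a minimal state-space realization (no real realization of the same transfer function has fewer than $n$ states) of the transfer function $G(s)=C(sI-A)^{-1}B+D$. Put $$P=\begin{bmatrix}A&B\\ C&D\end{bmatrix}\in\mathbb{R}^{(n+m)\times(n+m)} .$$ The system is called symmetrizable if there are an invertible $K\in\mathbb{R}^{m\times m}$ and a diagonal matrix $\Sigma_e$ with diagonal entries in $\{1,-1\}$ such that $H(s)=K^{-1}G(s)K$ satisfies $\Sigma_e H(s)^\top=H(s)\Sigma_e$ for all $s\in\mathbb{C}$ that are not eigenvalues of $A$. Let $P$ have exactly the distinct real eigenvalues $\lambda_1,\dots,\lambda_p$ and the distinct pairs of non-real complex-conjugate eigenvalues $(\lambda_{p+1},\bar\lambda_{p+1}),\dots,(\lambda_{p+q},\bar\lambda_{p+q})$, and let $r=p+q$. Let $t_j$ be the algebraic multiplicity of $\lambda_j$ if $\lambda_j\in\mathbb{R}$, and twice that multiplicity otherwise. Let $V\in\mathbb{R}^{(n+m)\times(n+m)}$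 be any invertible matrix such that $V^{-1}PV=\hat J_1\oplus\dots\oplus\hat J_r$ is a real Jordan normal form of $P$ in which $\hat J_j\in\mathbb{R}^{t_j\times t_j}$ is the direct sum of all real Jordan blocks belonging to $\lambda_j$ (to the pair $\lambda_j,\bar\lambda_j$ if $\lambda_j\notin\mathbb{R}$). Partition $$V=\begin{bmatrix}W\\ Z\end{bmatrix},\quad W=[W_1\ \cdots\ W_r]\in\mathbb{R}^{n\times(n+m)},\quad Z=[Z_1\ \cdots\ Z_r]\in\mathbb{R}^{m\times(n+m)},$$ with $W_j\in\mathbb{R}^{n\times t_j}$ and $Z_j\in\mathbb{R}^{m\times t_j}$, and let $Z\star W=[Z_1\otimes W_1\ \cdots\ Z_r\otimes W_r]$ be the column-wise Khatri–Rao product. If the system is symmetrizable, then $$\operatorname{rank}(Z\star W)<t_1^2+\dots+t_r^2 .$$ -/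

import Mathlib

open scoped Kronecker ComplexConjugate

noncomputable section

/-- A real linear time-invariant system `x' = A x + B u`, `y = C x + D u` with `n` states,
`m` inputs and `m` outputs. -/
structure StateSpace (n m : ℕ) where
  A : Matrix (Fin n) (Fin n) ℝ
  B : Matrix (Fin n) (Fin m) ℝ
  C : Matrix (Fin m) (Fin n) ℝ
  D : Matrix (Fin m) (Fin m) ℝ

namespace StateSpace

/-- The system matrix `P = [A B; C D]`. -/
def systemMatrix {n m : ℕ} (S : StateSpace n m) : Matrix (Fin n ⊕ Fin m) (Fin n ⊕ Fin m) ℝ :=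
  Matrix.fromBlocks S.A S.B S.C S.D

/-- The matrix `s I - A` over the complex numbers. -/
def pencil {n m : ℕ} (S : StateSpace n m) (s : ℂ) : Matrix (Fin n) (Fin n) ℂ :=
  s • (1 : Matrix (Fin n) (Fin n) ℂ) - S.A.map Complex.ofReal

/-- The points where `C (s I - A)⁻¹ B + D` is defined: `s` is not an eigenvalue of `A`. -/
def regularSet {n m : ℕ} (S : StateSpace n m) : Set ℂ :=
  {s | (S.pencil s).det ≠ 0}

/-- The transfer function `G(s) = C (s I - A)⁻¹ B + D`; it is only used on `S.regularSet`. -/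
def transfer {n m : ℕ} (S : StateSpace n m) (s : ℂ) : Matrix (Fin m) (Fin m) ℂ :=
  S.C.map Complex.ofReal * (S.pencil s)⁻¹ * S.B.map Complex.ofReal + S.D.map Complex.ofReal

/-- Two state-space models have the same transfer function (at all points where both
expressions are defined; these are all but finitely many points). -/
def SameTransfer {n k m : ℕ} (S : StateSpace n m) (S' : StateSpace k m) : Prop :=
  ∀ s ∈ S.regularSet ∩ S'.regularSet, S.transfer s = S'.transfer s

/-- A minimal realization: no realization of the same transfer function has fewer states. -/
def IsMinimal {n m : ℕ} (S : StateSpace n m) : Prop :=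
  ∀ (k : ℕ) (S' : StateSpace k m), S.SameTransfer S' → n ≤ k

end StateSpace

/-- A signature matrix: diagonal, with all diagonal entries `1` or `-1`. -/
def IsSignatureMatrix {m : ℕ} (E : Matrix (Fin m) (Fin m) ℝ) : Prop :=
  ∃ e : Fin m → ℝ, (∀ i, e i = 1 ∨ e i = -1) ∧ E = Matrix.diagonal e

/-- External symmetry of a transfer function `G` with domain `Ω`:
`Σₑ G(s)ᵀ = G(s) Σₑ` for one constant signature matrix `Σₑ`. -/
def IsSymmetricTransfer {m : ℕ} (Ω : Set ℂ) (G : ℂ → Matrix (Fin m) (Fin m) ℂ) : Prop :=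
  ∃ E : Matrix (Fin m) (Fin m) ℝ, IsSignatureMatrix E ∧
    ∀ s ∈ Ω, E.map Complex.ofReal * (G s).transpose = G s * E.map Complex.ofReal

/-- The system is symmetrizable: `H(s) = K⁻¹ G(s) K` is symmetric for some invertible real
constant matrix `K`. -/
def StateSpace.IsSymmetrizable {n m : ℕ} (S : StateSpace n m) : Prop :=
  ∃ K : Matrix (Fin m) (Fin m) ℝ, IsUnit K ∧
    IsSymmetricTransfer S.regularSet
      (fun s => (K⁻¹).map Complex.ofReal * S.transfer s * K.map Complex.ofReal)

/-- Algebraic multiplicity of the complex number `z` as an eigenvalue of the real matrix `P`. -/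
def eigMult {ι : Type*} [Fintype ι] [DecidableEq ι] (P : Matrix ι ι ℝ) (z : ℂ) : ℕ :=
  (P.map Complex.ofReal).charpoly.rootMultiplicity z

/-- `lam` lists the distinct real eigenvalues of `P` (the first `p` entries) and one member of
each of the distinct pairs of non-real complex-conjugate eigenvalues (the last `q` entries). -/
structure IsEigenvalueListing {ι : Type*} [Fintype ι] [DecidableEq ι] (P : Matrix ι ι ℝ)
    (p q : ℕ) (lam : Fin (p + q) → ℂ) : Prop where
  real_iff : ∀ j, (lam j).im = 0 ↔ (j : ℕ) < p
  distinct : ∀ i j, i ≠ j → lam i ≠ lam j ∧ lam i ≠ conj (lam j)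
  spectrum_iff : ∀ z : ℂ, (P.map Complex.ofReal).charpoly.IsRoot z ↔
    ∃ j, z = lam j ∨ z = conj (lam j)

/-- The size `t` belonging to `z`: its multiplicity if `z` is real, twice that otherwise. -/
def groupSize {ι : Type*} [Fintype ι] [DecidableEq ι] (P : Matrix ι ι ℝ) (z : ℂ) : ℕ :=
  if z.im = 0 then eigMult P z else 2 * eigMult P z

/-- The real Jordan block of size `s` for `z`. If `z` is real: `z` on the diagonal and `1` on the
superdiagonal. If `z = a + b i` is not real (`s` even): the `2 × 2` blocks `[a b; -b a]` on the
block diagonal and `2 × 2` identity matrices on the block superdiagonal. -/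
def realJordanBlock (z : ℂ) (s : ℕ) : Matrix (Fin s) (Fin s) ℝ :=
  Matrix.of fun i j =>
    if z.im = 0 then
      if (i : ℕ) = j then z.re else if (i : ℕ) + 1 = j then 1 else 0
    else
      if (i : ℕ) / 2 = j / 2 then
        if (i : ℕ) = j then z.re else if (i : ℕ) < j then z.im else -z.im
      else if (i : ℕ) + 2 = j then 1 else 0

/-- `J` is a direct sum of (non-empty) real Jordan blocks, all belonging to `z` (to the pair
`z`, `conj z` if `z` is not real). -/
def IsRealJordanGroup (z : ℂ) {t : ℕ} (J : Matrix (Fin t) (Fin t) ℝ) : Prop :=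
  ∃ (b : ℕ) (s : Fin b → ℕ) (h : ∑ i, s i = t),
    (∀ i, 0 < s i) ∧ (z.im ≠ 0 → ∀ i, Even (s i)) ∧
    J = Matrix.reindex (finSigmaFinEquiv.trans (finCongr h)) (finSigmaFinEquiv.trans (finCongr h))
      (Matrix.blockDiagonal' fun i => realJordanBlock z (s i))

/-- `V` is invertible and `V⁻¹ P V = Ĵ₁ ⊕ ⋯ ⊕ Ĵᵣ` is a real Jordan form of `P`, where `Ĵⱼ` has
size `t j` and consists of all Jordan blocks belonging to `lam j`. The columns of `V` are indexed
by pairs (group `j`, position in the group). -/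
def IsGroupedRealJordanBasis {ι : Type*} [Fintype ι] [DecidableEq ι] (P : Matrix ι ι ℝ)
    {r : ℕ} (lam : Fin r → ℂ) (t : Fin r → ℕ) (V : Matrix ι (Σ j : Fin r, Fin (t j)) ℝ) : Prop :=
  ∃ (V' : Matrix (Σ j : Fin r, Fin (t j)) ι ℝ) (J : (j : Fin r) → Matrix (Fin (t j)) (Fin (t j)) ℝ),
    V * V' = 1 ∧ V' * V = 1 ∧ (∀ j, IsRealJordanGroup (lam j) (J j)) ∧
    V' * P * V = Matrix.blockDiagonal' J

/-- The `j`-th column block `Mⱼ` of a column-partitioned matrix `M = [M₁ ⋯ Mᵣ]`. -/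
def columnBlock {κ : Type*} {r : ℕ} {t : Fin r → ℕ} (M : Matrix κ (Σ j : Fin r, Fin (t j)) ℝ)
    (j : Fin r) : Matrix κ (Fin (t j)) ℝ :=
  Matrix.of fun i c => M i ⟨j, c⟩

/-- The column-wise Khatri–Rao product `M ⋆ N = [M₁ ⊗ N₁ ⋯ Mᵣ ⊗ Nᵣ]`. -/
def khatriRao {κ κ' : Type*} {r : ℕ} {t s : Fin r → ℕ}
    (M : Matrix κ (Σ j : Fin r, Fin (t j)) ℝ) (N : Matrix κ' (Σ j : Fin r, Fin (s j)) ℝ) :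
    Matrix (κ × κ') (Σ j : Fin r, Fin (t j) × Fin (s j)) ℝ :=
  Matrix.of fun i c => (columnBlock M c.1 ⊗ₖ columnBlock N c.1) i c.2

end

section

open Filter Topology Polynomial

/-! ### Markov parameters -/

/-! Symmetrizability yields an invertible `X = K Σₑ Kᵀ` with `G X = X Gᵀ`. Thus `(A, B X, C, D X)`
and `(Aᵀ, Cᵀ, X Bᵀ, X Dᵀ)` realize the same transfer function and have the same Markov parameters.
Minimality makes `(C, A)` observable, hence `(Aᵀ, Cᵀ)` reachable, so some `T` satisfies `A T = T
Aᵀ`, `B X = T Cᵀ`, `C T = X Bᵀ` (`exists_intertwiner`). Together with `D X = X Dᵀ` this says `P Q =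
Q Pᵀ` for `Q = T ⊕ X`.

Put `N = V⁻¹ Q V⁻ᵀ`. Then `Ĵ N = N Ĵᵀ`, and since distinct groups have coprime annihilating
polynomials, `N = N₁ ⊕ ⋯ ⊕ Nᵣ` (`apply_eq_zero_of_blockDiagonal_mul`). The lower left block of `V N
Vᵀ = Q` reads `∑ Zⱼ Nⱼ Wⱼᵀ = 0`: the entries of the `Nⱼ` form a vector in the kernel of `Z ⋆ W`. It
is nonzero because `X ≠ 0`, so `Z ⋆ W`, with its `∑ tⱼ²` columns, lacks full column rank
(`khatriRao_rank_lt`). Invertibility of `T` plays no role. -/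

theorem map_ofReal_mul {α β γ : Type*} [Fintype β] (M : Matrix α β ℝ) (N : Matrix β γ ℝ) :
    (M * N).map Complex.ofReal = M.map Complex.ofReal * N.map Complex.ofReal :=
  Matrix.map_mul (f := Complex.ofRealHom)

theorem tendsto_matrix_pencil_inv {n : ℕ} (A : Matrix (Fin n) (Fin n) ℂ) :
    Tendsto (fun s : ℂ => (s • (1 : Matrix (Fin n) (Fin n) ℂ) - A)⁻¹)
      (Bornology.cobounded ℂ) (𝓝 0) := by
  -- The norm is auxiliary, there to make the matrices a Banach algebra; the limit concerns only the
  -- entrywise topology.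
  let _ := Matrix.linftyOpNormedRing (n := Fin n) (α := ℂ)
  let _ := Matrix.linftyOpNormedAlgebra (R := ℂ) (n := Fin n) (α := ℂ)
  have h := spectrum.resolvent_tendsto_cobounded (𝕜 := ℂ) A
  refine h.congr fun s => ?_
  rw [resolvent, Matrix.nonsing_inv_eq_ringInverse, Algebra.algebraMap_eq_smul_one]

theorem eventually_det_pencil_ne_zero {n : ℕ} (A : Matrix (Fin n) (Fin n) ℂ) :
    ∀ᶠ s in Bornology.cobounded ℂ, (s • (1 : Matrix (Fin n) (Fin n) ℂ) - A).det ≠ 0 := by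
  have hfin : {s : ℂ | A.charpoly.IsRoot s}.Finite :=
    Polynomial.finite_setOfPred_isRoot A.charpoly_monic.ne_zero
  have h := Bornology.isBounded_def.1 hfin.isBounded
  filter_upwards [h] with s hs h0
  apply hs
  rw [Set.mem_ofPred_eq, IsRoot, Matrix.eval_charpoly, ← h0, Matrix.scalar_apply,
    Matrix.smul_one_eq_diagonal]

theorem smul_pencil_inv {n : ℕ} (A : Matrix (Fin n) (Fin n) ℂ) {s : ℂ}
    (hs : (s • (1 : Matrix (Fin n) (Fin n) ℂ) - A).det ≠ 0) :
    s • (s • (1 : Matrix (Fin n) (Fin n) ℂ) - A)⁻¹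
      = 1 + A * (s • (1 : Matrix (Fin n) (Fin n) ℂ) - A)⁻¹ := by
  have h := Matrix.mul_nonsing_inv _ (isUnit_iff_ne_zero.2 hs)
  rw [sub_mul, smul_mul_assoc, one_mul] at h
  exact sub_eq_iff_eq_add.1 h

theorem tendsto_mul_pencil_inv_mul {n m : ℕ} (A : Matrix (Fin n) (Fin n) ℂ)
    (B : Matrix (Fin n) (Fin m) ℂ) (C : Matrix (Fin m) (Fin n) ℂ) :
    Tendsto (fun s : ℂ => C * (s • (1 : Matrix (Fin n) (Fin n) ℂ) - A)⁻¹ * B)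
      (Bornology.cobounded ℂ) (𝓝 0) := by
  have hc : Continuous fun R : Matrix (Fin n) (Fin n) ℂ => C * R * B := by fun_prop
  have h0 : C * (0 : Matrix (Fin n) (Fin n) ℂ) * B = 0 := by simp
  exact h0 ▸ (hc.tendsto 0).comp (tendsto_matrix_pencil_inv A)

/-- Equal transfer functions near infinity have equal feedthroughs and equal strictly proper
parts. -/
theorem feedthrough_eq_of_eventually_eq {n k m : ℕ} {A₁ : Matrix (Fin n) (Fin n) ℂ}
    {B₁ : Matrix (Fin n) (Fin m) ℂ} {C₁ : Matrix (Fin m) (Fin n) ℂ}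
    {A₂ : Matrix (Fin k) (Fin k) ℂ} {B₂ : Matrix (Fin k) (Fin m) ℂ}
    {C₂ : Matrix (Fin m) (Fin k) ℂ} {D₁ D₂ : Matrix (Fin m) (Fin m) ℂ}
    (h : ∀ᶠ s : ℂ in Bornology.cobounded ℂ,
      C₁ * (s • (1 : Matrix (Fin n) (Fin n) ℂ) - A₁)⁻¹ * B₁ + D₁
        = C₂ * (s • (1 : Matrix (Fin k) (Fin k) ℂ) - A₂)⁻¹ * B₂ + D₂) :
    D₁ = D₂ ∧ ∀ᶠ s : ℂ in Bornology.cobounded ℂ,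
      C₁ * (s • (1 : Matrix (Fin n) (Fin n) ℂ) - A₁)⁻¹ * B₁
        = C₂ * (s • (1 : Matrix (Fin k) (Fin k) ℂ) - A₂)⁻¹ * B₂ := by
  have h₁ := (tendsto_mul_pencil_inv_mul A₁ B₁ C₁).add_const D₁
  have h₂ := (tendsto_mul_pencil_inv_mul A₂ B₂ C₂).add_const D₂
  have hD : D₁ = D₂ := by
    simpa using tendsto_nhds_unique (h₁.congr' h) h₂
  refine ⟨hD, h.mono fun s hs => ?_⟩
  rw [hD] at hs
  exact add_right_cancel hs

/-- Multiplication by `s` turns `C (s - A)⁻¹ B` into `(C A) (s - A)⁻¹ B + C B`, whose feedthrough is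
the first Markov parameter. The remainder has the same shape with `C A` in place of `C`, so the step
iterates. -/
theorem strictlyProper_step {n k m : ℕ} {A₁ : Matrix (Fin n) (Fin n) ℂ}
    {B₁ : Matrix (Fin n) (Fin m) ℂ} {A₂ : Matrix (Fin k) (Fin k) ℂ}
    {B₂ : Matrix (Fin k) (Fin m) ℂ} {C₁ : Matrix (Fin m) (Fin n) ℂ}
    {C₂ : Matrix (Fin m) (Fin k) ℂ}
    (h : ∀ᶠ s : ℂ in Bornology.cobounded ℂ,
      C₁ * (s • (1 : Matrix (Fin n) (Fin n) ℂ) - A₁)⁻¹ * B₁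
        = C₂ * (s • (1 : Matrix (Fin k) (Fin k) ℂ) - A₂)⁻¹ * B₂) :
    C₁ * B₁ = C₂ * B₂ ∧ ∀ᶠ s : ℂ in Bornology.cobounded ℂ,
      (C₁ * A₁) * (s • (1 : Matrix (Fin n) (Fin n) ℂ) - A₁)⁻¹ * B₁
        = (C₂ * A₂) * (s • (1 : Matrix (Fin k) (Fin k) ℂ) - A₂)⁻¹ * B₂ := by
  have hstep : ∀ᶠ s : ℂ in Bornology.cobounded ℂ,
      (C₁ * A₁) * (s • (1 : Matrix (Fin n) (Fin n) ℂ) - A₁)⁻¹ * B₁ + C₁ * B₁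
        = (C₂ * A₂) * (s • (1 : Matrix (Fin k) (Fin k) ℂ) - A₂)⁻¹ * B₂ + C₂ * B₂ := by
    filter_upwards [h, eventually_det_pencil_ne_zero A₁, eventually_det_pencil_ne_zero A₂]
      with s hs h₁ h₂
    have hexp : ∀ {a : ℕ} {A : Matrix (Fin a) (Fin a) ℂ} (B : Matrix (Fin a) (Fin m) ℂ)
        (C : Matrix (Fin m) (Fin a) ℂ),
        (s • (1 : Matrix (Fin a) (Fin a) ℂ) - A).det ≠ 0 →
        (C * A) * (s • (1 : Matrix (Fin a) (Fin a) ℂ) - A)⁻¹ * B + C * B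
          = s • (C * (s • (1 : Matrix (Fin a) (Fin a) ℂ) - A)⁻¹ * B) := fun B C hA => by
      rw [← Matrix.smul_mul, ← Matrix.mul_smul, smul_pencil_inv _ hA, Matrix.mul_add,
        Matrix.add_mul, Matrix.mul_one, Matrix.mul_assoc C, add_comm]
    rw [hexp _ _ h₁, hexp _ _ h₂, hs]
  exact feedthrough_eq_of_eventually_eq hstep

theorem markov_eq_of_eventually_eq {n k m : ℕ} {A₁ : Matrix (Fin n) (Fin n) ℂ}
    {B₁ : Matrix (Fin n) (Fin m) ℂ} {A₂ : Matrix (Fin k) (Fin k) ℂ}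
    {B₂ : Matrix (Fin k) (Fin m) ℂ} (l : ℕ) (C₁ : Matrix (Fin m) (Fin n) ℂ)
    (C₂ : Matrix (Fin m) (Fin k) ℂ)
    (h : ∀ᶠ s : ℂ in Bornology.cobounded ℂ,
      C₁ * (s • (1 : Matrix (Fin n) (Fin n) ℂ) - A₁)⁻¹ * B₁
        = C₂ * (s • (1 : Matrix (Fin k) (Fin k) ℂ) - A₂)⁻¹ * B₂) :
    C₁ * A₁ ^ l * B₁ = C₂ * A₂ ^ l * B₂ := by
  induction l generalizing C₁ C₂ with
  | zero => simpa using (strictlyProper_step h).1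
  | succ l ih =>
    simpa only [pow_succ', Matrix.mul_assoc] using ih _ _ (strictlyProper_step h).2

/-! ### Observability and intertwiners -/

/-- Two realizations with equal Markov parameters, the first observable and the second reachable,
are intertwined by a linear map of the state spaces. -/
theorem exists_intertwiner {n k m : ℕ} {A₁ : Matrix (Fin n) (Fin n) ℝ}
    {B₁ : Matrix (Fin n) (Fin m) ℝ} {C₁ : Matrix (Fin m) (Fin n) ℝ}
    {A₂ : Matrix (Fin k) (Fin k) ℝ} {B₂ : Matrix (Fin k) (Fin m) ℝ}
    {C₂ : Matrix (Fin m) (Fin k) ℝ}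
    (hmarkov : ∀ l, C₁ * A₁ ^ l * B₁ = C₂ * A₂ ^ l * B₂)
    (hobs : ∀ x, (∀ l, (C₁ * A₁ ^ l).mulVec x = 0) → x = 0)
    (hreach : ∀ y, (∀ l, Matrix.vecMul y (A₂ ^ l * B₂) = 0) → y = 0) :
    ∃ T : Matrix (Fin n) (Fin k) ℝ, A₁ * T = T * A₂ ∧ B₁ = T * B₂ ∧ C₁ * T = C₂ := by
  -- Reachability maps on finitely supported input sequences; `T` will be `R₁` composed with a
  -- section of `R₂`.
  let R₁ := Finsupp.linearCombination ℝ (fun c : ℕ × Fin m => (A₁ ^ c.1 * B₁).col c.2)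
  let R₂ := Finsupp.linearCombination ℝ (fun c : ℕ × Fin m => (A₂ ^ c.1 * B₂).col c.2)
  have col_mul : ∀ {a b c : ℕ} (M : Matrix (Fin a) (Fin b) ℝ) (N : Matrix (Fin b) (Fin c) ℝ) i,
      (M * N).col i = M.mulVec (N.col i) := fun M N i => by
    ext j; simp [Matrix.mul_apply, Matrix.mulVec, dotProduct]
  -- Both sides factor the same Hankel matrix, whose entries are the Markov parameters.
  have hO : ∀ (l : ℕ) u, (C₁ * A₁ ^ l).mulVec (R₁ u) = (C₂ * A₂ ^ l).mulVec (R₂ u) := by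
    intro l u
    have : (C₁ * A₁ ^ l).mulVecLin ∘ₗ R₁ = (C₂ * A₂ ^ l).mulVecLin ∘ₗ R₂ := by
      ext c : 2
      simp only [R₁, R₂, LinearMap.comp_apply, Finsupp.lsingle_apply,
        Finsupp.linearCombination_single, one_smul, Matrix.mulVecLin_apply]
      rw [← col_mul, ← col_mul, ← Matrix.mul_assoc, ← Matrix.mul_assoc, Matrix.mul_assoc C₁,
        Matrix.mul_assoc C₂, ← pow_add, ← pow_add, hmarkov]
    exact LinearMap.congr_fun this u
  have hsurj : LinearMap.range R₂ = ⊤ := by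
    by_contra hne
    obtain ⟨f, hf, hle⟩ := Submodule.exists_le_ker_of_lt_top _ (lt_top_iff_ne_top.2 hne)
    have hfd : ∀ x, f x = dotProduct (fun i => f (Pi.single i 1)) x := by
      intro x
      conv_lhs => rw [pi_eq_sum_univ' x]
      simp [dotProduct, mul_comm]
    have hy : (fun i => f (Pi.single i 1)) = 0 := by
      refine hreach _ fun l => ?_
      ext i
      have : R₂ (Finsupp.single (l, i) 1) ∈ LinearMap.ker f := hle ⟨_, rfl⟩
      rw [LinearMap.mem_ker, hfd] at this
      simp only [R₂, Finsupp.linearCombination_single, one_smul] at this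
      exact this
    apply hf
    ext i
    simpa using congrFun hy i
  obtain ⟨g, hg⟩ := LinearMap.exists_rightInverse_of_surjective R₂ hsurj
  -- The section does not matter: by `hO` and observability, `ker R₂ ≤ ker R₁`.
  have hT : ∀ u, R₁ (g (R₂ u)) = R₁ u := by
    intro u
    rw [← sub_eq_zero, ← map_sub]
    refine hobs _ fun l => ?_
    rw [hO, map_sub, ← LinearMap.comp_apply R₂ g, hg]
    simp
  let T := LinearMap.toMatrix' (R₁ ∘ₗ g)
  have hTcol : ∀ (l : ℕ) i, T.mulVec ((A₂ ^ l * B₂).col i) = (A₁ ^ l * B₁).col i := by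
    intro l i
    have := hT (Finsupp.single (l, i) 1)
    simpa [R₁, R₂, T, LinearMap.toMatrix'_mulVec] using this
  have hpow : ∀ l : ℕ, T * (A₂ ^ l * B₂) = A₁ ^ l * B₁ := fun l =>
    Matrix.ext_col fun i => by rw [col_mul, hTcol]
  have hext : ∀ {a : ℕ} (M N : Matrix (Fin a) (Fin k) ℝ),
      (∀ l : ℕ, M * (A₂ ^ l * B₂) = N * (A₂ ^ l * B₂)) → M = N := by
    intro a M N h
    ext i j
    have : (M - N) i = 0 := by
      refine hreach _ fun l => ?_
      have h' : (M - N) * (A₂ ^ l * B₂) = 0 := by rw [Matrix.sub_mul, h, sub_self]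
      exact congrFun h' i
    simpa [sub_eq_zero] using congrFun this j
  refine ⟨T, hext _ _ fun l => ?_, ?_, hext _ _ fun l => ?_⟩
  · rw [Matrix.mul_assoc, hpow, Matrix.mul_assoc, ← Matrix.mul_assoc A₂, ← pow_succ', hpow,
      pow_succ', Matrix.mul_assoc]
  · simpa using (hpow 0).symm
  · rw [Matrix.mul_assoc, hpow, ← Matrix.mul_assoc, ← Matrix.mul_assoc, hmarkov]

namespace StateSpace

/-- An unobservable realization can be replaced by one with fewer states. -/
theorem exists_lt_sameTransfer_of_unobservable {n m : ℕ} (S : StateSpace n m) {x : Fin n → ℝ}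
    (hx : x ≠ 0) (hobs : ∀ l, (S.C * S.A ^ l).mulVec x = 0) :
    ∃ k < n, ∃ S' : StateSpace k m, S.SameTransfer S' := by
  -- The unobservable subspace is `A`-invariant and contained in `ker C`, so the system descends to
  -- the quotient by it.
  let U : Submodule ℝ (Fin n → ℝ) := ⨅ l : ℕ, LinearMap.ker (S.C * S.A ^ l).mulVecLin
  have hU : ∀ y, y ∈ U ↔ ∀ l, (S.C * S.A ^ l).mulVec y = 0 := fun y => by simp [U]
  have hUA : ∀ y ∈ U, S.A.mulVec y ∈ U := fun y hy => (hU _).2 fun l => by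
    rw [Matrix.mulVec_mulVec, Matrix.mul_assoc, ← pow_succ]
    exact (hU y).1 hy _
  let k := Module.finrank ℝ ((Fin n → ℝ) ⧸ U)
  have hk : k < n := by
    have h := U.finrank_quotient_add_finrank
    have h0 : 0 < Module.finrank ℝ U :=
      Module.finrank_pos_iff_exists_ne_zero.2
        ⟨⟨x, (hU x).2 hobs⟩, fun h => hx (congrArg Subtype.val h)⟩
    rw [Module.finrank_fin_fun] at h
    omega
  let e : ((Fin n → ℝ) ⧸ U) ≃ₗ[ℝ] (Fin k → ℝ) :=
    LinearEquiv.ofFinrankEq _ _ (by simp [k])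
  let f : (Fin n → ℝ) →ₗ[ℝ] (Fin k → ℝ) := e.toLinearMap ∘ₗ U.mkQ
  have hf : LinearMap.range f = ⊤ :=
    LinearMap.range_eq_top.2 (e.surjective.comp U.mkQ_surjective)
  have hker : ∀ y, f y = 0 ↔ y ∈ U := fun y => by simp [f]
  obtain ⟨g, hg⟩ := LinearMap.exists_rightInverse_of_surjective f hf
  have hgf : ∀ y, y - g (f y) ∈ U := fun y => by
    rw [← hker, map_sub, ← LinearMap.comp_apply f g, hg]; simp
  let F := LinearMap.toMatrix' f
  let G := LinearMap.toMatrix' g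
  have hF : ∀ y, F.mulVec y = f y := LinearMap.toMatrix'_mulVec f
  have hG : ∀ y, G.mulVec y = g y := LinearMap.toMatrix'_mulVec g
  have hA : F * S.A * G * F = F * S.A := by
    refine Matrix.ext_iff_mulVec.2 fun y => ?_
    simp only [← Matrix.mulVec_mulVec, hF, hG]
    rw [eq_comm, ← sub_eq_zero, ← map_sub, ← Matrix.mulVec_sub, hker]
    exact hUA _ (hgf y)
  have hC : S.C * G * F = S.C := by
    refine Matrix.ext_iff_mulVec.2 fun y => ?_
    simp only [← Matrix.mulVec_mulVec, hF, hG]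
    rw [eq_comm, ← sub_eq_zero, ← Matrix.mulVec_sub]
    simpa using (hU _).1 (hgf y) 0
  refine ⟨k, hk, ⟨F * S.A * G, F * S.B, S.C * G, S.D⟩, fun s ⟨hs, hs'⟩ => ?_⟩
  set S' : StateSpace k m := ⟨F * S.A * G, F * S.B, S.C * G, S.D⟩ with hS'
  have hpen : S'.pencil s * F.map Complex.ofReal = F.map Complex.ofReal * S.pencil s := by
    simp only [pencil, Matrix.sub_mul, Matrix.mul_sub, Matrix.smul_mul,
      Matrix.mul_smul, Matrix.one_mul, Matrix.mul_one, ← map_ofReal_mul, S', hA]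
  have hinv : (S'.pencil s)⁻¹ * F.map Complex.ofReal = F.map Complex.ofReal * (S.pencil s)⁻¹ := by
    have h₁ := Matrix.nonsing_inv_mul _ (isUnit_iff_ne_zero.2 hs')
    have h₂ := Matrix.mul_nonsing_inv _ (isUnit_iff_ne_zero.2 hs)
    calc _ = (S'.pencil s)⁻¹ * (F.map Complex.ofReal * S.pencil s) * (S.pencil s)⁻¹ := by
          rw [Matrix.mul_assoc, Matrix.mul_assoc, h₂, Matrix.mul_one]
      _ = _ := by rw [← hpen, ← Matrix.mul_assoc, h₁, Matrix.one_mul]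
  simp only [transfer]
  congr 1
  calc _ = (S.C * G * F).map Complex.ofReal * (S.pencil s)⁻¹ * S.B.map Complex.ofReal := by rw [hC]
    _ = (S.C * G).map Complex.ofReal * (F.map Complex.ofReal * (S.pencil s)⁻¹)
          * S.B.map Complex.ofReal := by rw [map_ofReal_mul (S.C * G), Matrix.mul_assoc _ (F.map _)]
    _ = _ := by
      rw [← hinv]
      simp only [map_ofReal_mul, Matrix.mul_assoc, S']

theorem IsMinimal.observable {n m : ℕ} {S : StateSpace n m} (h : S.IsMinimal) (x : Fin n → ℝ)
    (hx : ∀ l, (S.C * S.A ^ l).mulVec x = 0) : x = 0 := by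
  by_contra hne
  obtain ⟨k, hk, S', hS'⟩ := S.exists_lt_sameTransfer_of_unobservable hne hx
  exact absurd (h k S' hS') (not_le.2 hk)

end StateSpace

/-! ### The symmetrizer of the system matrix -/

theorem map_ofReal_injective {α β : Type*} {M N : Matrix α β ℝ}
    (h : M.map Complex.ofReal = N.map Complex.ofReal) : M = N :=
  Matrix.map_injective Complex.ofReal_injective h

theorem map_ofReal_pow {α : Type*} [Fintype α] [DecidableEq α] (M : Matrix α α ℝ) (l : ℕ) :
    (M ^ l).map Complex.ofReal = M.map Complex.ofReal ^ l :=
  Matrix.map_pow M Complex.ofRealHom l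

theorem IsSignatureMatrix.isUnit {m : ℕ} {E : Matrix (Fin m) (Fin m) ℝ}
    (h : IsSignatureMatrix E) : IsUnit E := by
  obtain ⟨e, he, rfl⟩ := h
  rw [Matrix.isUnit_diagonal, Pi.isUnit_iff]
  intro i
  rcases he i with h | h <;> simp [h]

theorem StateSpace.IsSymmetrizable.exists_transfer_mul {n m : ℕ} {S : StateSpace n m}
    (h : S.IsSymmetrizable) : ∃ X : Matrix (Fin m) (Fin m) ℝ, IsUnit X ∧
      ∀ s ∈ S.regularSet,
        S.transfer s * X.map Complex.ofReal = X.map Complex.ofReal * (S.transfer s).transpose := by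
  obtain ⟨K, hK, E, hE, hs⟩ := h
  have hKT : IsUnit K.transpose := Matrix.isUnit_transpose K |>.2 hK
  -- Multiplying `K⁻¹ G K Σₑ = Σₑ (K⁻¹ G K)ᵀ` by `K` on the left and `Kᵀ` on the right gives `G X =
  -- X Gᵀ` for this `X`.
  refine ⟨K * E * K.transpose, (hK.mul hE.isUnit).mul hKT, fun s hreg => ?_⟩
  have hsym := hs s hreg
  clear hs
  beta_reduce at hsym
  have hKinv : K.map Complex.ofReal * K⁻¹.map Complex.ofReal = 1 := by
    rw [← map_ofReal_mul, Matrix.mul_nonsing_inv _ ((Matrix.isUnit_iff_isUnit_det K).1 hK)]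
    simp
  have hKinvT : (K⁻¹.map Complex.ofReal).transpose * (K.map Complex.ofReal).transpose = 1 := by
    rw [← Matrix.transpose_mul, hKinv, Matrix.transpose_one]
  have hT : K.transpose.map Complex.ofReal = (K.map Complex.ofReal).transpose := rfl
  rw [map_ofReal_mul, map_ofReal_mul, hT]
  generalize S.transfer s = G at *
  generalize K.map Complex.ofReal = k at *
  generalize K⁻¹.map Complex.ofReal = k' at *
  generalize E.map Complex.ofReal = ε at *
  calc G * (k * ε * k.transpose)
      = (k * k') * G * (k * ε * k.transpose) := by rw [hKinv, Matrix.one_mul]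
    _ = k * (k' * G * k * ε) * k.transpose := by simp only [Matrix.mul_assoc]
    _ = k * (ε * (k' * G * k).transpose) * k.transpose := by rw [hsym]
    _ = k * ε * k.transpose * G.transpose * (k'.transpose * k.transpose) := by
      simp only [Matrix.transpose_mul, Matrix.mul_assoc]
    _ = _ := by rw [hKinvT, Matrix.mul_one]

/-- The system matrix of a minimal symmetrizable system is intertwined with its transpose by a
block diagonal matrix. -/
theorem StateSpace.IsMinimal.exists_systemMatrix_mul {n m : ℕ} {S : StateSpace n m}
    (hmin : S.IsMinimal) (hsym : S.IsSymmetrizable) :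
    ∃ (T : Matrix (Fin n) (Fin n) ℝ) (X : Matrix (Fin m) (Fin m) ℝ), IsUnit X ∧
      S.systemMatrix * Matrix.fromBlocks T 0 0 X
        = Matrix.fromBlocks T 0 0 X * S.systemMatrix.transpose := by
  obtain ⟨X, hX, hGX⟩ := hsym.exists_transfer_mul
  have hev : ∀ᶠ s : ℂ in Bornology.cobounded ℂ,
      S.C.map Complex.ofReal * (s • (1 : Matrix (Fin n) (Fin n) ℂ) - S.A.map Complex.ofReal)⁻¹
          * (S.B * X).map Complex.ofReal + (S.D * X).map Complex.ofReal
        = (X * S.B.transpose).map Complex.ofReal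
          * (s • (1 : Matrix (Fin n) (Fin n) ℂ) - S.A.transpose.map Complex.ofReal)⁻¹
          * S.C.transpose.map Complex.ofReal + (X * S.D.transpose).map Complex.ofReal := by
    filter_upwards [eventually_det_pencil_ne_zero (S.A.map Complex.ofReal)] with s hs
    have h := hGX s hs
    have hAT : s • (1 : Matrix (Fin n) (Fin n) ℂ) - S.A.transpose.map Complex.ofReal
        = (s • (1 : Matrix (Fin n) (Fin n) ℂ) - S.A.map Complex.ofReal).transpose := by
      rw [Matrix.transpose_sub, Matrix.transpose_smul, Matrix.transpose_one, Matrix.transpose_map]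
    rw [hAT, ← Matrix.transpose_nonsing_inv]
    simpa only [transfer, pencil, map_ofReal_mul, Matrix.transpose_map, Matrix.transpose_add,
      Matrix.transpose_mul, Matrix.mul_add, Matrix.add_mul, Matrix.mul_assoc] using h
  obtain ⟨hD, hev⟩ := feedthrough_eq_of_eventually_eq hev
  have hmarkov : ∀ l, S.C * S.A ^ l * (S.B * X)
      = X * S.B.transpose * S.A.transpose ^ l * S.C.transpose := fun l => by
    apply map_ofReal_injective
    simpa only [map_ofReal_mul, map_ofReal_pow] using markov_eq_of_eventually_eq l _ _ hev
  -- Reachability of `(Aᵀ, Cᵀ)` is observability of `(C, A)` transposed, so observability serves for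
  -- both hypotheses.
  obtain ⟨T, hA, hB, hC⟩ := exists_intertwiner hmarkov hmin.observable fun y hy =>
    hmin.observable y fun l => by
      rw [← hy l, ← Matrix.transpose_pow, ← Matrix.transpose_mul, Matrix.vecMul_transpose]
  refine ⟨T, X, hX, ?_⟩
  simp only [systemMatrix, Matrix.fromBlocks_transpose, Matrix.fromBlocks_multiply, hA, hB, hC,
    map_ofReal_injective hD, Matrix.mul_zero, Matrix.zero_mul, add_zero, zero_add]

/-! ### Real Jordan groups -/

/-- The real polynomial `(x - z) (x - conj z)`. -/
noncomputable def conjPairPoly (z : ℂ) : ℝ[X] := (X - C z.re) ^ 2 + C (z.im ^ 2)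

theorem aeval_conjPairPoly (z : ℂ) {ι : Type*} [Fintype ι] [DecidableEq ι] (M : Matrix ι ι ℝ) :
    aeval M (conjPairPoly z)
      = (M - z.re • (1 : Matrix ι ι ℝ)) ^ 2 + (z.im ^ 2) • (1 : Matrix ι ι ℝ) := by
  simp [conjPairPoly, Algebra.algebraMap_eq_smul_one, _root_.smul_pow]

theorem aeval_conjPairPoly_complex (z w : ℂ) :
    aeval w (conjPairPoly z) = (w - z) * (w - conj z) := by
  have hz : z = z.re + z.im * Complex.I := (Complex.re_add_im z).symm
  have hz' : conj z = z.re - z.im * Complex.I := by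
    apply Complex.ext <;> simp
  rw [hz', show w - z = w - (z.re + z.im * Complex.I) by rw [← hz]]
  simp only [conjPairPoly, map_add, map_pow, map_sub, aeval_X, aeval_C, Complex.coe_algebraMap]
  linear_combination ((z.im : ℂ) ^ 2) * Complex.I_sq

/-- A common complex root would lie in both `{z, conj z}` and `{w, conj w}`. Real `z` needs no
separate case: its polynomial is `(x - z)²`. -/
theorem isCoprime_conjPairPoly {z w : ℂ} (h : z ≠ w) (h' : z ≠ conj w) :
    IsCoprime (conjPairPoly z) (conjPairPoly w) := by
  rw [Polynomial.isCoprime_iff_aeval_ne_zero_of_isAlgClosed ℝ ℂ]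
  intro a
  by_contra! hc
  obtain ⟨h₁, h₂⟩ := hc
  rw [aeval_conjPairPoly_complex, mul_eq_zero, sub_eq_zero, sub_eq_zero] at h₁ h₂
  rcases h₁ with rfl | rfl <;> rcases h₂ with h₂ | h₂
  · exact h h₂
  · exact h' h₂
  · exact h' (by rw [← h₂, Complex.conj_conj])
  · exact h (star_injective h₂)

theorem pow_eq_zero_of_strictlyUpper {s : ℕ} {M : Matrix (Fin s) (Fin s) ℝ}
    (h : ∀ i j, j ≤ i → M i j = 0) : M ^ s = 0 := by
  have hM : M.charpoly = X ^ s := by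
    rw [Matrix.charpoly_of_isUpperTriangular M fun i j hij => h i j (le_of_lt hij)]
    simp [h _ _ le_rfl]
  simpa [hM] using M.aeval_self_charpoly

/-- After subtracting `z.re`, the `2 × 2` diagonal blocks are `z.im • [0 1; -1 0]`, with square
`-z.im²`. The added scalar cancels them, leaving only blocks above the diagonal. -/
theorem realJordanBlock_sq_apply_eq_zero {z : ℂ} (hz : z.im ≠ 0) {s : ℕ} (hs : Even s)
    (i j : Fin s) (hij : j ≤ i) :
    ((realJordanBlock z s - z.re • (1 : Matrix (Fin s) (Fin s) ℝ)) ^ 2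
      + (z.im ^ 2) • (1 : Matrix (Fin s) (Fin s) ℝ)) i j
      = 0 := by
  have hentry : ∀ a b : Fin s, (realJordanBlock z s - z.re • (1 : Matrix (Fin s) (Fin s) ℝ)) a b =
      if (a : ℕ) / 2 = b / 2 then (if (a : ℕ) = b then 0 else if (a : ℕ) < b then z.im else -z.im)
      else if (a : ℕ) + 2 = b then 1 else 0 := by
    intro a b
    by_cases hab : (a : ℕ) = b
    · obtain rfl := Fin.ext hab
      simp [realJordanBlock, hz]
    · have : a ≠ b := fun h => hab (by rw [h])
      simp [realJordanBlock, hz, hab, this]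
  obtain ⟨c, hc⟩ := hs
  -- `i'` is the other index of the `2 × 2` block of `i`; evenness of `s` keeps `i + 1` in range.
  -- For `j ≤ i` it alone contributes to the sum.
  obtain ⟨i', hi'⟩ : ∃ i' : Fin s,
      (i : ℕ) % 2 = 0 ∧ (i' : ℕ) = i + 1 ∨ (i : ℕ) % 2 = 1 ∧ (i' : ℕ) + 1 = i := by
    rcases Nat.mod_two_eq_zero_or_one i with h | h
    · exact ⟨⟨i + 1, by omega⟩, Or.inl ⟨h, rfl⟩⟩
    · exact ⟨⟨i - 1, by omega⟩, Or.inr ⟨h, Nat.sub_add_cancel (by omega)⟩⟩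
  have hsum : ((realJordanBlock z s - z.re • (1 : Matrix (Fin s) (Fin s) ℝ)) ^ 2) i j
      = (realJordanBlock z s - z.re • (1 : Matrix (Fin s) (Fin s) ℝ)) i i'
        * (realJordanBlock z s - z.re • (1 : Matrix (Fin s) (Fin s) ℝ)) i' j := by
    rw [pow_two, Matrix.mul_apply]
    refine Finset.sum_eq_single i' (fun k _ hk => ?_) (by simp)
    have hk' : (k : ℕ) ≠ i' := fun h => hk (Fin.ext h)
    have hij' : (j : ℕ) ≤ i := hij
    rw [hentry, hentry]
    by_cases h1 : (i : ℕ) / 2 = k / 2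
    · have : (i : ℕ) = k := by omega
      simp [this]
    · by_cases h2 : (i : ℕ) + 2 = k
      · rw [if_neg (show ¬ ((k : ℕ) / 2 = j / 2) by omega),
          if_neg (show ¬ ((k : ℕ) + 2 = j) by omega), mul_zero]
      · rw [if_neg h1, if_neg h2, zero_mul]
  have hij' : (j : ℕ) ≤ i := hij
  rw [Matrix.add_apply, hsum, hentry, hentry, Matrix.smul_apply, Matrix.one_apply]
  have h1 : (i : ℕ) / 2 = i' / 2 := by omega
  have h2 : (i : ℕ) ≠ i' := by omega
  rw [if_pos h1, if_neg h2]
  by_cases hEq : i = j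
  · subst hEq
    rw [if_pos h1.symm, if_neg h2.symm]
    rcases lt_or_gt_of_ne h2 with h | h
    · rw [if_pos h, if_neg (by omega)]; simp; ring
    · rw [if_neg (by omega), if_pos h]; simp; ring
  · have hne : (i : ℕ) ≠ j := fun h => hEq (Fin.ext h)
    rw [if_neg hEq]
    by_cases h3 : (i' : ℕ) = j
    · simp [h3]
    · rw [if_neg (show ¬ ((i' : ℕ) / 2 = j / 2) by omega),
        if_neg (show ¬ ((i' : ℕ) + 2 = j) by omega)]
      simp

theorem aeval_realJordanBlock_pow {z : ℂ} {s : ℕ} (hs : z.im ≠ 0 → Even s) :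
    aeval (realJordanBlock z s) (conjPairPoly z) ^ s = 0 := by
  rw [aeval_conjPairPoly]
  by_cases hz : z.im = 0
  · have h : (realJordanBlock z s - z.re • (1 : Matrix (Fin s) (Fin s) ℝ)) ^ s = 0 := by
      refine pow_eq_zero_of_strictlyUpper fun i j hij => ?_
      have hij' : (j : ℕ) ≤ i := hij
      by_cases hEq : i = j
      · subst hEq; simp [realJordanBlock, hz]
      · have hne : (i : ℕ) ≠ j := fun h => hEq (Fin.ext h)
        have : (i : ℕ) + 1 ≠ j := by omega
        simp [realJordanBlock, hz, hne, this, hEq]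
    rw [hz, zero_pow two_ne_zero, zero_smul, add_zero, ← pow_mul, mul_comm, pow_mul, h,
      zero_pow two_ne_zero]
  · exact pow_eq_zero_of_strictlyUpper (realJordanBlock_sq_apply_eq_zero hz (hs hz))

theorem IsRealJordanGroup.aeval_pow_eq_zero {z : ℂ} {t : ℕ} {J : Matrix (Fin t) (Fin t) ℝ}
    (h : IsRealJordanGroup z J) : aeval J (conjPairPoly z ^ t) = 0 := by
  obtain ⟨b, s, hst, -, heven, rfl⟩ := h
  rw [← Matrix.coe_reindexAlgEquiv ℝ ℝ, Polynomial.aeval_algHom_apply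
    (Matrix.reindexAlgEquiv ℝ ℝ (finSigmaFinEquiv.trans (finCongr hst)))]
  have hblock : aeval (Matrix.blockDiagonal' fun i => realJordanBlock z (s i)) (conjPairPoly z)
      = Matrix.blockDiagonal' fun i => aeval (realJordanBlock z (s i)) (conjPairPoly z) := by
    simp only [aeval_conjPairPoly]
    have h1 : (1 : Matrix (Σ i, Fin (s i)) (Σ i, Fin (s i)) ℝ)
        = Matrix.blockDiagonal' fun i => (1 : Matrix (Fin (s i)) (Fin (s i)) ℝ) :=
      Matrix.blockDiagonal'_one.symm
    rw [h1, ← Matrix.blockDiagonal'_smul, ← Matrix.blockDiagonal'_smul,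
      ← Matrix.blockDiagonal'_sub, ← Matrix.blockDiagonal'_pow, ← Matrix.blockDiagonal'_add]
    rfl
  rw [map_pow, hblock, ← Matrix.blockDiagonal'_pow]
  have hz : (fun i => aeval (realJordanBlock z (s i)) (conjPairPoly z)) ^ t = 0 := by
    funext i
    have hle : s i ≤ t := hst ▸ Finset.single_le_sum (fun _ _ => Nat.zero_le _) (Finset.mem_univ i)
    exact pow_eq_zero_of_le hle (aeval_realJordanBlock_pow fun h => heven h i)
  rw [hz]
  simp

/-- A Sylvester equation between matrices with coprime annihilating polynomials has only the
trivial solution. -/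
theorem eq_zero_of_mul_eq_mul_of_isCoprime {ι κ : Type*} [Fintype ι] [DecidableEq ι] [Fintype κ]
    [DecidableEq κ] {M : Matrix ι ι ℝ} {L : Matrix κ κ ℝ} {N : Matrix ι κ ℝ} {f g : ℝ[X]}
    (hfg : IsCoprime f g) (hf : aeval M f = 0) (hg : aeval L g = 0) (h : M * N = N * L) :
    N = 0 := by
  have hpow : ∀ l : ℕ, M ^ l * N = N * L ^ l := by
    intro l
    induction l with
    | zero => simp
    | succ l ih => rw [pow_succ, pow_succ, Matrix.mul_assoc, h, ← Matrix.mul_assoc, ih,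
        Matrix.mul_assoc]
  have hpoly : ∀ u : ℝ[X], aeval M u * N = N * aeval L u := by
    intro u
    induction u using Polynomial.induction_on' with
    | add u v hu hv => rw [map_add, map_add, Matrix.add_mul, Matrix.mul_add, hu, hv]
    | monomial l a => simp [aeval_monomial, Algebra.algebraMap_eq_smul_one, hpow]
  obtain ⟨a, b, hab⟩ := hfg
  -- Bézout: in `1 = a f + b g` the first term kills `N` from the left through `M`, the second from
  -- the right through `L`.
  have h1 : (1 : Matrix ι ι ℝ) * N = N * aeval L (a * f) + N * aeval L (b * g) := by
    rw [← hpoly (b * g), ← hpoly (a * f), ← Matrix.add_mul, ← map_add, hab, map_one]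
  rwa [← hpoly (a * f), map_mul, map_mul, hf, hg, mul_zero, mul_zero, Matrix.zero_mul,
    Matrix.mul_zero, add_zero, Matrix.one_mul] at h1

/-- The `(i, j)` block solves a Sylvester equation between `J i` and `(J j)ᵀ`; transposition
preserves annihilating polynomials, so these are coprime. -/
theorem apply_eq_zero_of_blockDiagonal_mul {r : ℕ} {t : Fin r → ℕ} {lam : Fin r → ℂ}
    (hlam : ∀ i j, i ≠ j → lam i ≠ lam j ∧ lam i ≠ conj (lam j))
    {J : (j : Fin r) → Matrix (Fin (t j)) (Fin (t j)) ℝ}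
    (hJ : ∀ j, IsRealJordanGroup (lam j) (J j))
    {N : Matrix (Σ j : Fin r, Fin (t j)) (Σ j : Fin r, Fin (t j)) ℝ}
    (hN : Matrix.blockDiagonal' J * N = N * (Matrix.blockDiagonal' J).transpose)
    {i j : Fin r} (hij : i ≠ j) (a : Fin (t i)) (b : Fin (t j)) : N ⟨i, a⟩ ⟨j, b⟩ = 0 := by
  let Nij : Matrix (Fin (t i)) (Fin (t j)) ℝ :=
    N.submatrix (fun a => ⟨i, a⟩) (fun b => ⟨j, b⟩)
  have hSylv : J i * Nij = Nij * (J j).transpose := by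
    ext a b
    have h := congrFun (congrFun hN ⟨i, a⟩) ⟨j, b⟩
    rw [Matrix.mul_apply, Matrix.mul_apply, Fintype.sum_sigma, Fintype.sum_sigma,
      Finset.sum_eq_single i, Finset.sum_eq_single j] at h
    · simpa [Matrix.mul_apply, Nij, Matrix.blockDiagonal'_apply_eq] using h
    · intro k _ hk
      simp [Matrix.blockDiagonal'_apply_ne _ _ _ hk.symm]
    · simp
    · intro k _ hk
      simp [Matrix.blockDiagonal'_apply_ne _ _ _ hk.symm]
    · simp
  have hT : aeval (J j).transpose (conjPairPoly (lam j) ^ t j) = 0 := by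
    have h := (hJ j).aeval_pow_eq_zero
    rw [map_pow, aeval_conjPairPoly] at h ⊢
    have h' := congrArg Matrix.transpose h
    simpa only [Matrix.transpose_pow, Matrix.transpose_add, Matrix.transpose_sub,
      Matrix.transpose_smul, Matrix.transpose_one, Matrix.transpose_zero] using h'
  have h0 := eq_zero_of_mul_eq_mul_of_isCoprime
    (isCoprime_conjPairPoly (hlam i j hij).1 (hlam i j hij).2).pow
    (hJ i).aeval_pow_eq_zero hT hSylv
  exact congrFun (congrFun h0 a) b

/-! ### The kernel of the Khatri–Rao product -/

theorem rank_lt_card_of_mulVec_eq_zero {α β : Type*} [Fintype α] [Fintype β]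
    {M : Matrix α β ℝ} {v : β → ℝ} (hv : v ≠ 0) (h : M.mulVec v = 0) :
    M.rank < Fintype.card β := by
  have hrn := LinearMap.finrank_range_add_finrank_ker M.mulVecLin
  have hpos : 0 < Module.finrank ℝ (LinearMap.ker M.mulVecLin) :=
    Module.finrank_pos_iff_exists_ne_zero.2
      ⟨⟨v, by simpa using h⟩, fun h0 => hv (congrArg Subtype.val h0)⟩
  rw [Module.finrank_fintype_fun_eq_card] at hrn
  rw [Matrix.rank]
  omega

/-- Vectorization: row `(x, y)` of `Z ⋆ W` applied to the entries of the diagonal blocks of `N` is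
entry `(x, y)` of `Z N Wᵀ`. Block diagonality ensures that no entry of `N` is lost. -/
theorem khatriRao_rank_lt {κ κ' : Type*} [Fintype κ] [Fintype κ'] {r : ℕ} {t : Fin r → ℕ}
    {Z : Matrix κ (Σ j : Fin r, Fin (t j)) ℝ} {W : Matrix κ' (Σ j : Fin r, Fin (t j)) ℝ}
    {N : Matrix (Σ j : Fin r, Fin (t j)) (Σ j : Fin r, Fin (t j)) ℝ} (hN : N ≠ 0)
    (hblock : ∀ i j, i ≠ j → ∀ a b, N ⟨i, a⟩ ⟨j, b⟩ = 0) (h : Z * N * W.transpose = 0) :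
    (khatriRao Z W).rank < ∑ j, t j ^ 2 := by
  have hcard : ∑ j, t j ^ 2 = Fintype.card (Σ j : Fin r, Fin (t j) × Fin (t j)) := by
    simp [Fintype.card_sigma, pow_two]
  rw [hcard]
  refine rank_lt_card_of_mulVec_eq_zero
    (v := fun c => N ⟨c.1, c.2.1⟩ ⟨c.1, c.2.2⟩) (fun hv => hN ?_) ?_
  · ext ⟨i, a⟩ ⟨j, b⟩
    by_cases hij : i = j
    · subst hij
      exact congrFun hv ⟨i, a, b⟩
    · exact hblock i j hij a b
  · ext ⟨x, y⟩
    have hxy := congrFun (congrFun h x) y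
    rw [Matrix.mul_assoc, Matrix.mul_apply, Fintype.sum_sigma] at hxy
    rw [Matrix.mulVec, dotProduct, Fintype.sum_sigma]
    refine Eq.trans ?_ hxy
    refine Finset.sum_congr rfl fun j _ => ?_
    rw [Fintype.sum_prod_type]
    refine Finset.sum_congr rfl fun a _ => ?_
    rw [Matrix.mul_apply, Fintype.sum_sigma, Finset.sum_eq_single j, Finset.mul_sum]
    · refine Finset.sum_congr rfl fun b _ => ?_
      simp only [khatriRao, columnBlock, Matrix.of_apply, Matrix.kroneckerMap_apply,
        Matrix.transpose_apply]
      ring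
    · intro k _ hk
      exact Finset.sum_eq_zero fun b _ => by rw [hblock j k hk.symm, zero_mul]
    · simp

theorem khatriRao_rank_lt_of_mul_fromBlocks {κ κ' : Type*} [Fintype κ] [Fintype κ']
    [DecidableEq κ] [DecidableEq κ'] {r : ℕ} {t : Fin r → ℕ} {lam : Fin r → ℂ}
    (hlam : ∀ i j, i ≠ j → lam i ≠ lam j ∧ lam i ≠ conj (lam j))
    {P : Matrix (κ' ⊕ κ) (κ' ⊕ κ) ℝ} {V : Matrix (κ' ⊕ κ) (Σ j : Fin r, Fin (t j)) ℝ}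
    (hV : IsGroupedRealJordanBasis P lam t V)
    {W : Matrix κ' (Σ j : Fin r, Fin (t j)) ℝ} {Z : Matrix κ (Σ j : Fin r, Fin (t j)) ℝ}
    (hVWZ : V = Matrix.fromRows W Z) {T : Matrix κ' κ' ℝ} {X : Matrix κ κ ℝ} (hX : X ≠ 0)
    (hPQ : P * Matrix.fromBlocks T 0 0 X = Matrix.fromBlocks T 0 0 X * P.transpose) :
    (khatriRao Z W).rank < ∑ j, t j ^ 2 := by
  obtain ⟨V', J, hVV', -, hJ, hPJ⟩ := hV
  obtain ⟨Q, hQ⟩ : ∃ Q, Q = Matrix.fromBlocks T 0 0 X := ⟨_, rfl⟩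
  rw [← hQ] at hPQ
  have hVV'T : V'.transpose * V.transpose = 1 := by
    rw [← Matrix.transpose_mul, hVV', Matrix.transpose_one]
  have hN : V * (V' * Q * V'.transpose) * V.transpose = Q := by
    calc _ = (V * V') * Q * (V'.transpose * V.transpose) := by simp only [Matrix.mul_assoc]
      _ = Q := by rw [hVV', hVV'T, Matrix.one_mul, Matrix.mul_one]
  have hJN : Matrix.blockDiagonal' J * (V' * Q * V'.transpose)
      = (V' * Q * V'.transpose) * (Matrix.blockDiagonal' J).transpose := by
    calc _ = V' * P * (V * V') * Q * V'.transpose := by rw [← hPJ]; simp only [Matrix.mul_assoc]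
      _ = V' * (P * Q) * V'.transpose := by
        rw [hVV', Matrix.mul_one, Matrix.mul_assoc V']
      _ = V' * Q * (V'.transpose * V.transpose) * P.transpose * V'.transpose := by
        rw [hPQ, hVV'T, Matrix.mul_one, ← Matrix.mul_assoc V']
      _ = _ := by rw [← hPJ]; simp only [Matrix.transpose_mul, Matrix.mul_assoc]
  refine khatriRao_rank_lt (N := V' * Q * V'.transpose) (fun h0 => ?_)
    (fun i j hij a b => apply_eq_zero_of_blockDiagonal_mul hlam hJ hJN hij a b) ?_
  · have hQ0 : Matrix.fromBlocks T 0 0 X = 0 := by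
      rw [← hQ, ← hN, h0, Matrix.mul_zero, Matrix.zero_mul]
    exact hX (Matrix.ext fun i j => congrFun (congrFun hQ0 (Sum.inr i)) (Sum.inr j))
  · rw [hVWZ] at hN
    ext i j
    exact congrFun (congrFun (hN.trans hQ) (Sum.inr i)) (Sum.inl j)

end

theorem theorem2 (n m : ℕ) (hm : 0 < m) (S : StateSpace n m) (hmin : S.IsMinimal)
    (p q : ℕ) (lam : Fin (p + q) → ℂ) (hlam : IsEigenvalueListing S.systemMatrix p q lam)
    (V : Matrix (Fin n ⊕ Fin m) (Σ j : Fin (p + q), Fin (groupSize S.systemMatrix (lam j))) ℝ)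
    (hV : IsGroupedRealJordanBasis S.systemMatrix lam
      (fun j => groupSize S.systemMatrix (lam j)) V)
    (W : Matrix (Fin n) (Σ j : Fin (p + q), Fin (groupSize S.systemMatrix (lam j))) ℝ)
    (Z : Matrix (Fin m) (Σ j : Fin (p + q), Fin (groupSize S.systemMatrix (lam j))) ℝ)
    (hVWZ : V = Matrix.fromRows W Z)
    (hsym : S.IsSymmetrizable) :
    (khatriRao Z W).rank < ∑ j : Fin (p + q), (groupSize S.systemMatrix (lam j)) ^ 2 := by
  obtain ⟨T, X, hX, hPQ⟩ := hmin.exists_systemMatrix_mul hsym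
  refine khatriRao_rank_lt_of_mul_fromBlocks hlam.distinct hV hVWZ (fun h0 => ?_) hPQ
  -- For `m = 0` the zero matrix is invertible; `m > 0` is what makes the unit `X` nonzero.
  have : Nonempty (Fin m) := ⟨⟨0, hm⟩⟩
  exact hX.ne_zero h0
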